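/- Let $K$ be a field with a nonarchimedean valuation $\mathrm{val}\colon K^*\to\mathbb{R}$, with value group $\Gamma=\mathrm{val}(K^*)$, such that the residue field is infinite and the valuation has a splitting, i.e. a group homomorphism $\phi\colon\Gamma\to K^*$ with $\mathrm{val}\circ\phi=\mathrm{id}_\Gamma$. Put $\nu=-\mathrm{val}$. For a subset $X$ of a coordinate space $K^I$ ($I$ finite), let $\nu(X)\subseteq\mathbb{R}^I$ be the set of coordinatewise $\nu$-values of the points of $X$ with all coordinates nonzero, and let $\mathrm{trop}(X)=\overline{\nu(X)}$ be its closure in the Euclidean topology. Let $n$ be a positive integer and $[n]=\{1,\dots,n\}$. - $\mathrm{Gr}_K(n,2n)\subseteq K^{\binom{[2n]}{n}}$ is the set of all vectors of Plücker coordinates (defined up to a nonzero scalar) of $n$-dimensional subspaces of $K^{2n}$. - $\mathrm{Fl}_K(n)\subseteq K^{2^{[n]}}$, the complete affine flag variety, is the set of all $(q_S)_{S\subseteq[n]}$ for which there is a complete flag $\{0\}=L_0\subset L_1\subset\dots\subset L_n=K^n$, $\dim L_k=k$, such that for each $k=0,\dots,n$ the vector $(q_S)_{|S|=k}$ is a vector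 of Plücker coordinates of $L_k$ (each of these $n+1$ vectors may be scaled independently by a nonzero scalar). - $\mathrm{SUBMOD}_n\subseteq\mathbb{R}^{2^{[n]}}$ is the set of functions $F$ with $F(S\cap T)+F(S\cup T)\le F(S)+F(T)$ for all $S,T\subseteq[n]$. - $\mathcal{L}_n=\{p\in\mathbb{R}^{\binom{[2n]}{n}} : p(C)=p(D)\text{ whenever } C\cap[n]=D\cap[n]\}$, identified with $\mathbb{R}^{2^{[n]}}$ by letting $F\in\mathbb{R}^{2^{[n]}}$ correspond to the function $C\mapsto F(C\cap[n])$ in $\mathcal{L}_n$. Then $$\nu(\mathrm{Gr}_K(n,2n))\cap\mathcal{L}_n=\nu(\mathrm{Fl}_K(n))\cap\mathrm{SUBMOD}_n .$$ If moreover the valuation is nontrivial and $K$ is algebraically closed or real closed, then $$\mathrm{trop}(\mathrm{Gr}_K(n,2n))\cap\mathcal{L}_n=\mathrm{trop}(\mathrm{Fl}_K(n))\cap\mathrm{SUBMOD}_n .$$ -/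

import Mathlib

/-! ### Valued fields

A nonarchimedean valuation `val : K* → ℝ` is an `AddValuation K (WithTop ℝ)`, the value `⊤` being
taken at `0` only. -/

/-- The valuation ring `{a | val a ≥ 0}`. -/
noncomputable def valRing {K : Type*} [Field K] (v : AddValuation K (WithTop ℝ)) :
    ValuationSubring K :=
  (AddValuation.toValuation v).valuationSubring

theorem mem_valRing_iff {K : Type*} [Field K] (v : AddValuation K (WithTop ℝ)) (a : K) :
    a ∈ valRing v ↔ 0 ≤ v a :=
  Iff.rfl

/-- The value group `Γ = val(K*)`, an additive subgroup of `ℝ`. -/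
def valGroup {K : Type*} [Field K] (v : AddValuation K (WithTop ℝ)) : AddSubgroup ℝ where
  carrier := {γ | ∃ a : Kˣ, v (a : K) = (γ : WithTop ℝ)}
  zero_mem' := ⟨1, by simp⟩
  add_mem' := by
    rintro x y ⟨a, ha⟩ ⟨b, hb⟩
    exact ⟨a * b, by simp [ha, hb]⟩
  neg_mem' := by
    rintro x ⟨a, ha⟩
    exact ⟨a⁻¹, by rw [Units.val_inv_eq_inv_val, AddValuation.map_inv, ha]; rfl⟩

/-- A splitting (cross-section) of `val`: a group homomorphism `φ : Γ → K*` with `val ∘ φ = id`. -/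
def HasSplitting {K : Type*} [Field K] (v : AddValuation K (WithTop ℝ)) : Prop :=
  ∃ φ : Multiplicative (valGroup v) →* Kˣ,
    ∀ γ : valGroup v, v (φ (Multiplicative.ofAdd γ) : K) = ((γ : ℝ) : WithTop ℝ)

/-- `ν = -val` (only used at nonzero elements of `K`). -/
noncomputable def nu {K : Type*} [Field K] (v : AddValuation K (WithTop ℝ)) (a : K) : ℝ :=
  -(v a).untop₀

/-- `ν(X)`: the coordinatewise `ν`-values of the points of `X` all of whose coordinates are
nonzero. -/
def nuSet {K : Type*} [Field K] (v : AddValuation K (WithTop ℝ)) {ι : Type*} (X : Set (ι → K)) :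
    Set (ι → ℝ) :=
  (fun x i => nu v (x i)) '' {x | x ∈ X ∧ ∀ i, x i ≠ 0}

/-- `trop(X)`: the Euclidean closure of `ν(X)`. -/
def tropSet {K : Type*} [Field K] (v : AddValuation K (WithTop ℝ)) {ι : Type*}
    (X : Set (ι → K)) : Set (ι → ℝ) :=
  closure (nuSet v X)

/-! ### Grassmannians and flag varieties -/

/-- The set of `k`-element subsets of `{0, …, N - 1}`. -/
abbrev KSubset (N k : ℕ) : Type := {S : Finset (Fin N) // S.card = k}

/-- `p` is a vector of Plücker coordinates of `L`, and `dim L = k`: up to a nonzero scalar, the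
entries of `p` are the maximal minors of a `k × N` matrix whose rows form a basis of `L`. -/
def IsPluckerVector {K : Type*} [Field K] {N k : ℕ} (L : Submodule K (Fin N → K))
    (p : KSubset N k → K) : Prop :=
  ∃ (b : Module.Basis (Fin k) K L) (c : Kˣ), ∀ S : KSubset N k,
    p S = (c : K) *
      (Matrix.of fun i j : Fin k => (b i : Fin N → K) (S.1.orderEmbOfFin S.2 j)).det

/-- The Grassmannian `Gr_K(k, N)` in Plücker coordinates (all representatives of the projective
points). -/
def grassmannian (K : Type*) [Field K] (k N : ℕ) : Set (KSubset N k → K) :=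
  {p | ∃ L : Submodule K (Fin N → K), IsPluckerVector L p}

/-- The complete affine flag variety `Fl_K(n)` in `K^(2^[n])`: the vectors `q` for which there is a
complete flag `L 0 ⊆ L 1 ⊆ … ⊆ L n` such that, for every `k`, the space `L k` has dimension `k` and
`(q S : |S| = k)` is a vector of Plücker coordinates of `L k`. -/
def affineFlagVariety (K : Type*) [Field K] (n : ℕ) : Set (Finset (Fin n) → K) :=
  {q | ∃ L : Fin (n + 1) → Submodule K (Fin n → K), Monotone L ∧
    ∀ k : Fin (n + 1), IsPluckerVector (k := (k : ℕ)) (L k) fun S => q S.1}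

/-! ### Submodular functions and the linear space `L_n` -/

/-- The cone of submodular functions on the subsets of `[n]`. -/
def submodularCone (n : ℕ) : Set (Finset (Fin n) → ℝ) :=
  {F | ∀ S T : Finset (Fin n), F (S ∩ T) + F (S ∪ T) ≤ F S + F T}

/-- `C ∩ [n]` for a subset `C` of `[2n]`, as a subset of `[n]`; here `[n]` is the first half of
`[2n]`. -/
def lowerPart {n : ℕ} (C : Finset (Fin (n + n))) : Finset (Fin n) :=
  Finset.univ.filter fun i => Fin.castAdd n i ∈ C

/-- The linear space `L_n` of all `p` with `p C = p D` whenever `C ∩ [n] = D ∩ [n]`. -/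
def Lspace (n : ℕ) : Submodule ℝ (KSubset (n + n) n → ℝ) where
  carrier := {p | ∀ C D : KSubset (n + n) n, lowerPart C.1 = lowerPart D.1 → p C = p D}
  add_mem' := by
    intro p q hp hq C D h
    simp [hp C D h, hq C D h]
  zero_mem' := by
    intro C D _
    rfl
  smul_mem' := by
    intro c p hp C D h
    simp [hp C D h]

/-- The `n`-element subset `S ∪ T` of `[2n]`, where `T` is the set of all `n + i` with `i ∉ S`. -/
def extendSet {n : ℕ} (S : Finset (Fin n)) : KSubset (n + n) n :=
  ⟨(S.map (Fin.castAddEmb n)).disjUnion (Sᶜ.map (Fin.natAddEmb n)) (by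
      rw [Finset.disjoint_left]
      intro x hx hy
      simp only [Finset.mem_map] at hx hy
      obtain ⟨a, _, rfl⟩ := hx
      obtain ⟨b, _, h⟩ := hy
      have := congrArg Fin.val h
      simp at this
      omega), by
    rw [Finset.card_disjUnion, Finset.card_map, Finset.card_map, Finset.card_compl,
      Fintype.card_fin]
    have := S.card_le_univ
    simp at this
    omega⟩

theorem lowerPart_extendSet {n : ℕ} (S : Finset (Fin n)) : lowerPart (extendSet S).1 = S := by
  ext i
  simp only [lowerPart, extendSet, Finset.mem_filter, Finset.mem_univ, true_and,
    Finset.mem_disjUnion, Finset.mem_map]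
  constructor
  · rintro (⟨a, ha, h⟩ | ⟨a, _, h⟩)
    · have := congrArg Fin.val h
      simp at this
      rwa [← Fin.ext this]
    · have := congrArg Fin.val h
      simp at this
      omega
  · intro h
    exact Or.inl ⟨i, h, rfl⟩

/-- The identification of `L_n` with `ℝ^(2^[n])`: it sends `p` to `S ↦ p (S ∪ T)` for any `T` in
`{n + 1, …, 2n}` of size `n - |S|`, and its inverse sends `F` to `C ↦ F (C ∩ [n])`. -/
def LspaceEquiv (n : ℕ) : Lspace n ≃ₗ[ℝ] (Finset (Fin n) → ℝ) where
  toFun p S := p.1 (extendSet S)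
  map_add' _ _ := rfl
  map_smul' _ _ := rfl
  invFun F := ⟨fun C => F (lowerPart C.1), fun _ _ h => congrArg F h⟩
  left_inv p := by
    ext C
    exact p.2 _ _ (lowerPart_extendSet _)
  right_inv F := by
    ext S
    exact congrArg F (lowerPart_extendSet S)

/-- A set of functions on the subsets of `[n]`, regarded as a subset of `L_n`, and hence of
`ℝ^([2n] choose n)`. -/
def inLspace {n : ℕ} (A : Set (Finset (Fin n) → ℝ)) : Set (KSubset (n + n) n → ℝ) :=
  (fun F => ((LspaceEquiv n).symm F : KSubset (n + n) n → ℝ)) '' A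

/-! A point of the Grassmannian with no zero coordinate is, up to a scalar, the vector of maximal
minors of some `(A | 1)`, and these are up to sign all minors of `A` of all sizes
(`val_minor_extendOne`). Lying in `Lspace` means that the valuation of a minor of `A` depends only
on its columns.

From Grassmannian to flags: the spans of the first `k` rows of `A` form a flag whose Plücker
coordinates are the minors on those rows. Submodularity comes from the Desnanot–Jacobi identity
`minor_snoc_snoc`: both products on its right have the same valuation on `Lspace`, so the
ultrametric inequality is the local submodular inequality (`flagSet_mem_submodularCone`).

From flags to Grassmannian: a matrix `A` adapted to the flag, with all minors of the valuations
prescribed by `q`, is built row by row (`exists_minorsMatch_of_flag`). A new row is chosen in the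
next space, zero in the first `k` columns and scaled so that the full-size minors are right. The
same identity with submodularity shows that smaller minors through this row have at least the
prescribed valuation (`val_le_val_minor_snoc`). Adding generic integral multiples of the earlier
rows turns these bounds into equalities (`exists_val_minor_snoc_eq`); this needs an infinite residue
field.

For closures, one direction is continuity, together with closedness of the three-term inequality. In
the other, approximants of a submodular limit need not be submodular; scaling the Plücker vectors of
the flag independently adds a small strictly submodular function of `|S|`, which repairs this
(`mem_closure_inter_submodularCone`). -/

/-! ### Minors -/

/-- The determinant of the matrix of the entries of the vectors `u i` in the columns `c j`. -/
def minor {K κ : Type*} [CommRing K] {m : ℕ} (u : Fin m → κ → K) (c : Fin m → κ) : K :=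
  (Matrix.of fun i j => u i (c j)).det

theorem AddValuation.map_intUnits_mul {K : Type*} [Field K] (v : AddValuation K (WithTop ℝ))
    (u : ℤˣ) (x : K) : v (((u : ℤ) : K) * x) = v x := by
  rcases Int.units_eq_one_or u with rfl | rfl <;> simp [AddValuation.map_neg]

theorem val_minor_comp_row {K κ : Type*} [Field K] (v : AddValuation K (WithTop ℝ)) {m : ℕ}
    (u : Fin m → κ → K) (c : Fin m → κ) (σ : Equiv.Perm (Fin m)) :
    v (minor (u ∘ σ) c) = v (minor u c) := by
  have := Matrix.det_permute σ (Matrix.of fun i j => u i (c j))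
  exact (congrArg v this).trans (v.map_intUnits_mul _ _)

theorem val_minor_comp_col {K κ : Type*} [Field K] (v : AddValuation K (WithTop ℝ)) {m : ℕ}
    (u : Fin m → κ → K) (c : Fin m → κ) (σ : Equiv.Perm (Fin m)) :
    v (minor u (c ∘ σ)) = v (minor u c) := by
  have := Matrix.det_permute' σ (Matrix.of fun i j => u i (c j))
  exact (congrArg v this).trans (v.map_intUnits_mul _ _)

theorem exists_perm_of_image_eq {κ : Type*} [DecidableEq κ] {m : ℕ} {c d : Fin m → κ}
    (hc : Function.Injective c) (hd : Function.Injective d)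
    (h : Finset.univ.image c = Finset.univ.image d) : ∃ σ : Equiv.Perm (Fin m), d = c ∘ σ := by
  have hr : Set.range c = Set.range d := by
    have := congrArg (fun s : Finset κ => (s : Set κ)) h
    simpa using this
  refine ⟨(Equiv.ofInjective d hd).trans ((Equiv.setCongr hr.symm).trans
    (Equiv.ofInjective c hc).symm), ?_⟩
  ext i
  simp [Equiv.apply_ofInjective_symm hc]

theorem val_minor_eq_of_image_eq {K κ : Type*} [Field K] [DecidableEq κ]
    (v : AddValuation K (WithTop ℝ)) {m : ℕ}
    (u : Fin m → κ → K) {c d : Fin m → κ} (hc : Function.Injective c) (hd : Function.Injective d)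
    (h : Finset.univ.image c = Finset.univ.image d) : v (minor u c) = v (minor u d) := by
  obtain ⟨σ, rfl⟩ := exists_perm_of_image_eq hc hd h
  exact (val_minor_comp_col v u c σ).symm

theorem minor_snoc_add {K κ : Type*} [CommRing K] {m : ℕ} (u : Fin m → κ → K) (x y : κ → K)
    (c : Fin (m + 1) → κ) :
    minor (Fin.snoc u (x + y)) c = minor (Fin.snoc u x) c + minor (Fin.snoc u y) c := by
  have h := Matrix.det_updateRow_add (Matrix.of fun i j => (Fin.snoc u x : Fin (m + 1) → κ → K) i (c j))
    (Fin.last m) (x ∘ c) (y ∘ c)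
  have key (z : κ → K) : (Matrix.of fun i j => (Fin.snoc u x : Fin (m + 1) → κ → K) i (c j)).updateRow
      (Fin.last m) (z ∘ c) = Matrix.of fun i j => (Fin.snoc u z : Fin (m + 1) → κ → K) i (c j) := by
    ext i j
    refine Fin.lastCases ?_ (fun i => ?_) i <;> simp [Matrix.updateRow_apply]
  have hxy : x ∘ c + y ∘ c = (x + y) ∘ c := rfl
  rw [hxy, key, key, key] at h
  exact h

theorem minor_snoc_smul {K κ : Type*} [CommRing K] {m : ℕ} (u : Fin m → κ → K) (t : K) (x : κ → K)
    (c : Fin (m + 1) → κ) :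
    minor (Fin.snoc u (t • x)) c = t * minor (Fin.snoc u x) c := by
  have h := Matrix.det_updateRow_smul (Matrix.of fun i j => (Fin.snoc u x : Fin (m + 1) → κ → K) i (c j))
    (Fin.last m) t (x ∘ c)
  have key (z : κ → K) : (Matrix.of fun i j => (Fin.snoc u x : Fin (m + 1) → κ → K) i (c j)).updateRow
      (Fin.last m) (z ∘ c) = Matrix.of fun i j => (Fin.snoc u z : Fin (m + 1) → κ → K) i (c j) := by
    ext i j
    refine Fin.lastCases ?_ (fun i => ?_) i <;> simp [Matrix.updateRow_apply]
  have hxy : t • (x ∘ c) = (t • x) ∘ c := rfl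
  rw [hxy, key, key] at h
  exact h

theorem minor_eq_zero_of_row_eq {K κ : Type*} [CommRing K] {m : ℕ} {u : Fin m → κ → K}
    {i j : Fin m} (hij : i ≠ j) (h : u i = u j) (c : Fin m → κ) : minor u c = 0 :=
  Matrix.det_zero_of_row_eq hij (by ext l; simp [h])

theorem minor_eq_zero_of_row_eq_zero {K κ : Type*} [CommRing K] {m : ℕ} {u : Fin m → κ → K}
    {c : Fin m → κ} (i : Fin m) (h : ∀ j, u i (c j) = 0) : minor u c = 0 :=
  Matrix.det_eq_zero_of_row_eq_zero i h

/-- The entry in row `x` and column `i` of the Schur complement of the block with rows `u` and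
columns `c`. -/
noncomputable def schurEntry {K κ : Type*} [Field K] {m : ℕ} (u : Fin m → κ → K) (c : Fin m → κ)
    (x : κ → K) (i : κ) : K :=
  x i - (Matrix.vecMul (x ∘ c) (Matrix.of fun a b => u a (c b))⁻¹) ⬝ᵥ fun a => u a i

/-- The Schur complement formula for the determinant of a block matrix. -/
theorem minor_append {K κ : Type*} [Field K] {m l : ℕ} (u : Fin m → κ → K)
    (c : Fin m → κ) (x : Fin l → κ → K) (d : Fin l → κ) (h : minor u c ≠ 0) :
    minor (Fin.append u x) (Fin.append c d) =
      minor u c * (Matrix.of fun a b => schurEntry u c (x a) (d b)).det := by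
  set P : Matrix (Fin m) (Fin m) K := Matrix.of fun a b => u a (c b) with hP
  have hu : IsUnit P.det := isUnit_iff_ne_zero.2 h
  let _ : Invertible P := P.invertibleOfIsUnitDet hu
  unfold minor
  rw [← Matrix.det_submatrix_equiv_self finSumFinEquiv]
  have : ((Matrix.of fun i j => Fin.append u x i (Fin.append c d j)).submatrix
      finSumFinEquiv finSumFinEquiv) = Matrix.fromBlocks P (Matrix.of fun a b => u a (d b))
        (Matrix.of fun a b => x a (c b)) (Matrix.of fun a b => x a (d b)) := by
    ext i j
    rcases i with i | i <;> rcases j with j | j <;> simp [hP]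
  rw [this, Matrix.det_fromBlocks₁₁]
  congr 2

theorem minor_snoc {K κ : Type*} [Field K] {m : ℕ} (u : Fin m → κ → K) (c : Fin m → κ)
    (x : κ → K) (i : κ) (h : minor u c ≠ 0) :
    minor (Fin.snoc u x) (Fin.snoc c i) = minor u c * schurEntry u c x i := by
  have := minor_append u c ![x] ![i] h
  rw [Fin.append_right_eq_snoc, Fin.append_right_eq_snoc] at this
  simpa using this

theorem append_pair {α : Type*} {m : ℕ} (f : Fin m → α) (a b : α) :
    Fin.append f ![a, b] = (Fin.snoc (Fin.snoc f a : Fin (m + 1) → α) b : Fin (m + 2) → α) := by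
  ext i
  refine Fin.lastCases ?_ (fun i => ?_) i
  · have : Fin.last (m + 1) = Fin.natAdd m (1 : Fin 2) := rfl
    rw [Fin.snoc_last, this, Fin.append_right]; rfl
  · refine Fin.lastCases ?_ (fun i => ?_) i
    · have : (Fin.last m).castSucc = Fin.natAdd m (0 : Fin 2) := rfl
      rw [Fin.snoc_castSucc, Fin.snoc_last, this, Fin.append_right]; rfl
    · have : i.castSucc.castSucc = Fin.castAdd 2 i := rfl
      rw [Fin.snoc_castSucc, Fin.snoc_castSucc, this, Fin.append_left]

/-- The Desnanot–Jacobi identity: expand the `2 × 2` determinant of Schur complement entries. It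
drives both directions of the theorem. -/
theorem minor_snoc_snoc {K κ : Type*} [Field K] {m : ℕ} (u : Fin m → κ → K) (c : Fin m → κ)
    (x y : κ → K) (i j : κ) (h : minor u c ≠ 0) :
    minor u c * minor (Fin.snoc (Fin.snoc u x : Fin (m + 1) → κ → K) y : Fin (m + 2) → κ → K)
        (Fin.snoc (Fin.snoc c i : Fin (m + 1) → κ) j : Fin (m + 2) → κ) =
      minor (Fin.snoc u x) (Fin.snoc c i) * minor (Fin.snoc u y) (Fin.snoc c j) -
      minor (Fin.snoc u x) (Fin.snoc c j) * minor (Fin.snoc u y) (Fin.snoc c i) := by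
  have := minor_append u c ![x, y] ![i, j] h
  rw [append_pair, append_pair, Matrix.det_fin_two] at this
  rw [this, minor_snoc _ _ _ _ h, minor_snoc _ _ _ _ h, minor_snoc _ _ _ _ h, minor_snoc _ _ _ _ h]
  simp
  ring

/-- Vectors of `L` have minors proportional to those of a basis of `L`. -/
theorem exists_minor_eq_mul {K κ : Type*} [Field K] {k : ℕ} {L : Submodule K (κ → K)}
    (b : Module.Basis (Fin k) K L) (u : Fin k → κ → K) (hu : ∀ i, u i ∈ L)
    (hli : LinearIndependent K u) :
    ∃ t : K, t ≠ 0 ∧ ∀ c, minor u c = t * minor (fun i => (b i : κ → K)) c := by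
  have hli' : LinearIndependent K (fun i => (⟨u i, hu i⟩ : L)) :=
    LinearIndependent.of_comp L.subtype hli
  refine ⟨b.det fun i => ⟨u i, hu i⟩, ?_, fun c => ?_⟩
  · have : Module.Finite K L := Module.Finite.of_basis b
    have hs : Submodule.span K (Set.range fun i => (⟨u i, hu i⟩ : L)) = ⊤ :=
      hli'.span_eq_top_of_card_eq_finrank' (by simp [Module.finrank_eq_card_basis b])
    exact ((Module.Basis.is_basis_iff_det b).1 ⟨hli', hs⟩).ne_zero
  · rw [Module.Basis.det_apply, ← Matrix.det_transpose, minor, minor, ← Matrix.det_mul]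
    congr 1
    ext i j
    have := congrArg (fun z : L => (z : κ → K) (c j)) (b.sum_repr ⟨u i, hu i⟩)
    simp only [Submodule.coe_sum, Submodule.coe_smul, Finset.sum_apply, Pi.smul_apply,
      smul_eq_mul] at this
    rw [Matrix.mul_apply, Matrix.of_apply, ← this]
    rfl

/-! ### Injective tuples -/

theorem image_snoc {α : Type*} [DecidableEq α] {m : ℕ} (c : Fin m → α) (i : α) :
    Finset.univ.image (Fin.snoc c i : Fin (m + 1) → α) = insert i (Finset.univ.image c) := by
  ext x
  simp [Fin.exists_fin_succ', eq_comm, or_comm]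

theorem injective_snoc {α : Type*} {m : ℕ} {c : Fin m → α} (hc : Function.Injective c) {i : α}
    (hi : ∀ l, c l ≠ i) : Function.Injective (Fin.snoc c i : Fin (m + 1) → α) :=
  Fin.snoc_injective_iff.2 ⟨hc, by simpa using hi⟩

theorem snoc_comp_eq {α β : Type*} {m : ℕ} (A : α → β) (r : Fin m → α) (s : α) :
    (Fin.snoc (A ∘ r) (A s) : Fin (m + 1) → β) = A ∘ (Fin.snoc r s : Fin (m + 1) → α) := by
  ext i
  refine Fin.lastCases ?_ (fun i => ?_) i <;> simp

theorem snoc_comp_castSucc {β : Type*} {m k : ℕ} (A : Fin k → β) (a : β) (r : Fin m → Fin k) :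
    (Fin.snoc (A ∘ r) a : Fin (m + 1) → β) = (Fin.snoc A a : Fin (k + 1) → β) ∘
      (Fin.snoc (Fin.castSucc ∘ r) (Fin.last k) : Fin (m + 1) → Fin (k + 1)) := by
  ext i
  refine Fin.lastCases ?_ (fun i => ?_) i <;> simp

theorem injective_snoc_castSucc {m k : ℕ} {r : Fin m → Fin k} (hr : Function.Injective r) :
    Function.Injective (Fin.snoc (Fin.castSucc ∘ r) (Fin.last k) : Fin (m + 1) → Fin (k + 1)) :=
  injective_snoc ((Fin.castSucc_injective k).comp hr) fun l => (Fin.castSucc_lt_last (r l)).ne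

theorem exists_swap_eq_snoc {α : Type*} {m : ℕ} (c : Fin (m + 1) → α) (l : Fin (m + 1)) :
    ∃ U : Fin m → α, c ∘ Equiv.swap l (Fin.last m) = Fin.snoc U (c l) := by
  refine ⟨Fin.init (c ∘ Equiv.swap l (Fin.last m)), ?_⟩
  conv_lhs => rw [← Fin.snoc_init_self (c ∘ Equiv.swap l (Fin.last m))]
  simp

/-! ### Generic row operations -/

theorem WithTop.le_of_add_le_add_left_of_left_ne_top {a b c : WithTop ℝ} (ha : a ≠ ⊤)
    (h : a + b ≤ a + c) : b ≤ c :=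
  (WithTop.add_le_add_iff_left ha).1 h

/-- If the residue field is infinite, then finitely many sums `x i + t * y i` can be kept from
cancelling by one choice of the integral element `t`. -/
theorem exists_val_add_mul_eq {K : Type*} [Field K] (v : AddValuation K (WithTop ℝ))
    (hres : Infinite (IsLocalRing.ResidueField (valRing v))) {ι : Type*} [Finite ι]
    (x y : ι → K) (hy : ∀ i, y i ≠ 0) (hxy : ∀ i, v (y i) ≤ v (x i)) :
    ∃ t : K, 0 ≤ v t ∧ ∀ i, v (x i + t * y i) = v (y i) := by
  classical
  cases nonempty_fintype ι
  have hz : ∀ i, x i / y i ∈ valRing v := fun i => by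
    rw [mem_valRing_iff]
    have h1 : v (y i) + v (x i / y i) = v (x i) := by
      rw [← v.map_mul, mul_div_cancel₀ _ (hy i)]
    refine WithTop.le_of_add_le_add_left_of_left_ne_top (v.ne_top_iff.2 (hy i)) ?_
    rw [h1, add_zero]
    exact hxy i
  let z : ι → valRing v := fun i => ⟨x i / y i, hz i⟩
  -- After division by `y i`, it suffices that `z i + t` be a unit, so the residue of `t` need only
  -- avoid the finitely many residues of `-z i`.
  obtain ⟨t', ht'⟩ := Infinite.exists_notMem_finset
    (Finset.univ.image fun i => -IsLocalRing.residue (valRing v) (z i))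
  obtain ⟨t, rfl⟩ := IsLocalRing.residue_surjective t'
  refine ⟨t, (mem_valRing_iff v _).1 t.2, fun i => ?_⟩
  have hu : IsUnit (z i + t) := by
    rw [← IsLocalRing.residue_ne_zero_iff_isUnit, map_add]
    intro h0
    exact ht' (Finset.mem_image.2 ⟨i, Finset.mem_univ _, neg_eq_of_add_eq_zero_right h0⟩)
  have hv : v ((z i + t : valRing v) : K) = 0 := by
    obtain ⟨w, hw⟩ := hu
    have h1 : 0 ≤ v ((w : valRing v) : K) := (mem_valRing_iff v _).1 (w : valRing v).2
    have h2 : 0 ≤ v (((w⁻¹ : (valRing v)ˣ) : valRing v) : K) := (mem_valRing_iff v _).1 (SetLike.coe_mem _)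
    have h3 : v ((w : valRing v) : K) + v (((w⁻¹ : (valRing v)ˣ) : valRing v) : K) = 0 := by
      rw [← v.map_mul, ← MulMemClass.coe_mul, Units.mul_inv]
      simp
    rw [← hw]
    refine le_antisymm ?_ h1
    rw [← h3]
    exact le_add_of_nonneg_right h2
  have : x i + t * y i = y i * ((z i + t : valRing v) : K) := by
    have := hy i
    simp only [z, AddMemClass.coe_add]
    field_simp
  rw [this, v.map_mul, hv, add_zero]

/-! ### Matrices whose minors have prescribed valuations -/

/-- All minors of the matrix with rows `A` have the valuations which `q` prescribes, depending only
on the columns. -/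
def MinorsMatch {K : Type*} [Field K] (v : AddValuation K (WithTop ℝ)) {n k : ℕ}
    (q : Finset (Fin n) → K) (A : Fin k → Fin n → K) : Prop :=
  ∀ (m : ℕ) (r : Fin m → Fin k) (c : Fin m → Fin n), Function.Injective r →
    Function.Injective c → v (minor (A ∘ r) c) = v (q (Finset.univ.image c))

/-- The local form of submodularity of `-v (q S)`. -/
def ValSubmodular {K : Type*} [Field K] (v : AddValuation K (WithTop ℝ)) {n : ℕ}
    (q : Finset (Fin n) → K) : Prop :=
  ∀ (U : Finset (Fin n)) (i j : Fin n), i ∉ U → j ∉ U → i ≠ j →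
    v (q (insert i U)) + v (q (insert j U)) ≤ v (q U) + v (q (insert j (insert i U)))

theorem val_minor_snoc_perm {K : Type*} [Field K] (v : AddValuation K (WithTop ℝ)) {n k : ℕ}
    (A : Fin k → Fin n → K) (a : Fin n → K) {r : Fin k → Fin k} (hr : Function.Injective r)
    (c : Fin (k + 1) → Fin n) :
    v (minor (Fin.snoc (A ∘ r) a) c) = v (minor (Fin.snoc A a) c) := by
  rw [snoc_comp_castSucc]
  exact val_minor_comp_row v _ c (Equiv.ofBijective _
    (Finite.injective_iff_bijective.1 (injective_snoc_castSucc hr)))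

/-- Induction downward on the size of the minor (`d = k - m`), starting from the full-size minors.
Within one size, induction on the number `N` of columns outside the first `k`; at `N = 0` the row
`a` vanishes and the valuation is `⊤`. -/
theorem val_le_val_minor_snoc {K : Type*} [Field K] (v : AddValuation K (WithTop ℝ)) {n k : ℕ}
    (hk : k ≤ n) {q : Finset (Fin n) → K} (hq : ∀ S, q S ≠ 0) (hsub : ValSubmodular v q)
    {A : Fin k → Fin n → K} (hA : MinorsMatch v q A) {a : Fin n → K}
    (ha : ∀ j : Fin n, (j : ℕ) < k → a j = 0)
    (hfull : ∀ c : Fin (k + 1) → Fin n, Function.Injective c →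
      v (minor (Fin.snoc A a) c) = v (q (Finset.univ.image c)))
    (d : ℕ) : ∀ (m : ℕ), m + d = k → ∀ (r : Fin m → Fin k) (c : Fin (m + 1) → Fin n),
      Function.Injective r → Function.Injective c →
      v (q (Finset.univ.image c)) ≤ v (minor (Fin.snoc (A ∘ r) a) c) := by
  induction d with
  | zero =>
    intro m hm r c hr hc
    obtain rfl : m = k := by omega
    rw [val_minor_snoc_perm v A a hr, hfull c hc]
  | succ d ih =>
    intro m hm r c hr
    obtain ⟨s, hs⟩ : ∃ s, ∀ l, r l ≠ s := by
      by_contra! h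
      have := Fintype.card_le_of_surjective r h
      simp at this
      omega
    obtain ⟨N, hN⟩ : ∃ N, N = ((Finset.univ.image c).filter fun j : Fin n => k ≤ (j : ℕ)).card := ⟨_, rfl⟩
    induction N generalizing c with
    | zero =>
      intro _
      rw [minor_eq_zero_of_row_eq_zero (Fin.last m), v.map_zero]
      · exact le_top
      · intro j
        rw [Fin.snoc_last]
        apply ha
        by_contra! h
        have := Finset.card_eq_zero.1 hN.symm
        exact Finset.notMem_empty (c j) (this ▸ Finset.mem_filter.2
          ⟨Finset.mem_image_of_mem _ (Finset.mem_univ _), h⟩)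
    | succ N ihN =>
      intro hc
      obtain ⟨l, hl⟩ : ∃ l, k ≤ (c l : ℕ) := by
        have : 0 < ((Finset.univ.image c).filter fun j : Fin n => k ≤ (j : ℕ)).card := by omega
        obtain ⟨x, hx⟩ := Finset.card_pos.1 this
        rw [Finset.mem_filter, Finset.mem_image] at hx
        obtain ⟨⟨l, _, rfl⟩, h⟩ := hx
        exact ⟨l, h⟩
      obtain ⟨U, hU⟩ := exists_swap_eq_snoc c l
      set j := c l with hj
      have hcj : Function.Injective (Fin.snoc U j : Fin (m + 1) → Fin n) := by
        rw [← hU]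
        exact hc.comp (Equiv.injective _)
      have him : Finset.univ.image c = insert j (Finset.univ.image U) := by
        rw [← image_snoc, ← hU, ← Finset.image_image, Finset.image_univ_equiv]
      rw [← val_minor_comp_col v _ c (Equiv.swap l (Fin.last m)), hU, him]
      obtain ⟨hUi, hUj⟩ := Fin.snoc_injective_iff.1 hcj
      have hUj' : j ∉ Finset.univ.image U := by simpa using hUj
      -- `U` has only `m < k` columns. Exchanging `j` for `i` lowers `N`, so the inner hypothesis
      -- applies to `U, i`.
      obtain ⟨i, hik, hiU⟩ : ∃ i : Fin n, (i : ℕ) < k ∧ i ∉ Finset.univ.image U := by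
        by_contra! h
        have h1 : Finset.univ.image (Fin.castLE hk) ⊆ Finset.univ.image U := by
          intro x hx
          obtain ⟨y, _, rfl⟩ := Finset.mem_image.1 hx
          exact h _ y.2
        have h2 := Finset.card_le_card h1
        rw [Finset.card_image_of_injective _ (Fin.castLE_injective hk),
          Finset.card_image_of_injective _ hUi] at h2
        simp at h2
        omega
      have hij : i ≠ j := by
        rintro rfl
        omega
      have hci : Function.Injective (Fin.snoc U i : Fin (m + 1) → Fin n) :=
        injective_snoc hUi (by simpa using hiU)
      have hfi := ihN (Fin.snoc U i) (by
        rw [him, Finset.filter_insert, if_pos hl, Finset.card_insert_of_notMem] at hN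
        · rw [image_snoc, Finset.filter_insert, if_neg (by omega)]
          omega
        · exact fun h => hUj' (Finset.mem_filter.1 h).1) hci
      rw [image_snoc] at hfi
      have hrs : Function.Injective (Fin.snoc r s : Fin (m + 1) → Fin k) := injective_snoc hr hs
      have hD : v (minor (A ∘ r) U) = v (q (Finset.univ.image U)) := hA m r U hr hUi
      have hD0 : minor (A ∘ r) U ≠ 0 := by
        rw [← v.ne_top_iff, hD, v.ne_top_iff]
        exact hq _
      have hgi := hA _ _ _ hrs hci
      have hgj := hA _ _ _ hrs hcj
      rw [← snoc_comp_eq, image_snoc] at hgi hgj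
      have hbig := ih (m + 1) (by omega) (Fin.snoc r s)
        (Fin.snoc (Fin.snoc U i : Fin (m + 1) → Fin n) j) hrs
        (injective_snoc hci (by
          intro l'
          refine Fin.lastCases ?_ (fun l' => ?_) l'
          · simpa using hij
          · simpa using fun h => hUj ⟨l', h⟩))
      rw [image_snoc, image_snoc, ← snoc_comp_eq] at hbig
      have hrel := minor_snoc_snoc (A ∘ r) U (A s) a i j hD0
      have hrel' := (sub_eq_iff_eq_add.1 hrel.symm)
      have hsub' := hsub (Finset.univ.image U) i j hiU hUj' hij
      -- Solve the identity for the product containing the wanted minor. Of the two remaining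
      -- products, one is bounded by the outer hypothesis and submodularity, the other by the inner
      -- hypothesis.
      refine WithTop.le_of_add_le_add_left_of_left_ne_top (v.ne_top_iff.2 (hq (insert i
        (Finset.univ.image U)))) ?_
      have hfi' : v (q (insert i (Finset.univ.image U))) +
          v (minor (Fin.snoc (A ∘ r) a) (Fin.snoc U j)) =
          v (minor (Fin.snoc (A ∘ r) (A s)) (Fin.snoc U i) *
            minor (Fin.snoc (A ∘ r) a) (Fin.snoc U j)) := by
        rw [← hgi, ← v.map_mul]
      rw [hfi', hrel']
      refine v.map_le_add ?_ ?_
      · rw [v.map_mul, hD]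
        exact hsub'.trans (by gcongr)
      · rw [v.map_mul, hgj, add_comm]
        gcongr

/-- `T` is the set of rows already added to `a` with generic coefficients. Adding `t • A s` affects
only minors that omit row `s`; there `t` multiplies a minor of `A` of exactly the prescribed
valuation, so a generic `t` gives equality. -/
theorem exists_val_minor_snoc_eq {K : Type*} [Field K] (v : AddValuation K (WithTop ℝ))
    (hres : Infinite (IsLocalRing.ResidueField (valRing v))) {n k : ℕ}
    {q : Finset (Fin n) → K} (hq : ∀ S, q S ≠ 0)
    {A : Fin k → Fin n → K} (hA : MinorsMatch v q A) {L : Submodule K (Fin n → K)}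
    (hAL : ∀ s, A s ∈ L) {a : Fin n → K} (haL : a ∈ L)
    (hle : ∀ (m : ℕ) (r : Fin m → Fin k) (c : Fin (m + 1) → Fin n),
      Function.Injective r → Function.Injective c →
      v (q (Finset.univ.image c)) ≤ v (minor (Fin.snoc (A ∘ r) a) c))
    (hfull : ∀ c : Fin (k + 1) → Fin n, Function.Injective c →
      v (minor (Fin.snoc A a) c) = v (q (Finset.univ.image c))) (T : Finset (Fin k)) :
    ∃ b ∈ L, ∀ (m : ℕ) (r : Fin m → Fin k) (c : Fin (m + 1) → Fin n),
      Function.Injective r → Function.Injective c →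
      v (q (Finset.univ.image c)) ≤ v (minor (Fin.snoc (A ∘ r) b) c) ∧
      ((Function.Surjective r ∨ ∃ s ∈ T, ∀ l, r l ≠ s) →
        v (minor (Fin.snoc (A ∘ r) b) c) = v (q (Finset.univ.image c))) := by
  classical
  induction T using Finset.induction_on with
  | empty =>
    refine ⟨a, haL, fun m r c hr hc => ⟨hle m r c hr hc, ?_⟩⟩
    rintro (hs | ⟨s, hs, _⟩)
    · obtain rfl : m = k := by
        simpa using Fintype.card_congr (Equiv.ofBijective r ⟨hr, hs⟩)
      rw [val_minor_snoc_perm v A a hr, hfull c hc]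
    · exact absurd hs (Finset.notMem_empty s)
  | insert s T _ ih =>
    obtain ⟨b, hbL, hb⟩ := ih
    -- All minors that omit row `s`; bounding `m` by `k` makes this type finite, so that one `t`
    -- serves them all.
    let ι := {x : Σ m : Fin (k + 1), (Fin m → Fin k) × (Fin (m + 1) → Fin n) //
      Function.Injective x.2.1 ∧ Function.Injective x.2.2 ∧ ∀ l, x.2.1 l ≠ s}
    have hy : ∀ i : ι, v (minor (Fin.snoc (A ∘ i.1.2.1) (A s)) i.1.2.2) =
        v (q (Finset.univ.image i.1.2.2)) := fun i => by
      rw [snoc_comp_eq]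
      exact hA _ _ _ (injective_snoc i.2.1 i.2.2.2) i.2.2.1
    obtain ⟨t, -, ht⟩ := exists_val_add_mul_eq v hres
      (fun i : ι => minor (Fin.snoc (A ∘ i.1.2.1) b) i.1.2.2)
      (fun i : ι => minor (Fin.snoc (A ∘ i.1.2.1) (A s)) i.1.2.2)
      (fun i => by rw [← v.ne_top_iff, hy, v.ne_top_iff]; exact hq _)
      (fun i => by rw [hy]; exact (hb _ _ _ i.2.1 i.2.2.1).1)
    refine ⟨b + t • A s, L.add_mem hbL (L.smul_mem t (hAL s)), fun m r c hr hc => ?_⟩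
    rw [minor_snoc_add, minor_snoc_smul]
    by_cases hs : ∀ l, r l ≠ s
    · have hm : m < k + 1 := by
        have := Fintype.card_le_of_injective r hr
        simp at this
        omega
      let i : ι := ⟨⟨⟨m, hm⟩, r, c⟩, hr, hc, hs⟩
      have h1 := (ht i).trans (hy i)
      exact ⟨h1.ge, fun _ => h1⟩
    · push Not at hs
      obtain ⟨l, hl⟩ := hs
      -- A minor already using row `s` does not change, since the added term has a repeated row.
      rw [minor_eq_zero_of_row_eq (u := Fin.snoc (A ∘ r) (A s)) (Fin.castSucc_lt_last l).ne
        (by simp [hl]), mul_zero, add_zero]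
      refine ⟨(hb m r c hr hc).1, fun h => (hb m r c hr hc).2 (h.imp_right ?_)⟩
      rintro ⟨s', hs', h'⟩
      rcases Finset.mem_insert.1 hs' with rfl | h''
      · exact absurd hl (h' l)
      · exact ⟨s', h'', h'⟩

theorem MinorsMatch.snoc {K : Type*} [Field K] {v : AddValuation K (WithTop ℝ)} {n k : ℕ}
    {q : Finset (Fin n) → K} {A : Fin k → Fin n → K} (hA : MinorsMatch v q A) {b : Fin n → K}
    (hb : ∀ (m : ℕ) (r : Fin m → Fin k) (c : Fin (m + 1) → Fin n),
      Function.Injective r → Function.Injective c →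
      v (minor (Fin.snoc (A ∘ r) b) c) = v (q (Finset.univ.image c))) :
    MinorsMatch v q (Fin.snoc A b : Fin (k + 1) → Fin n → K) := by
  have key (m : ℕ) (r : Fin m → Fin (k + 1)) (hr : Function.Injective r)
      (h : ∀ l, r l ≠ Fin.last k) : ∃ r₀ : Fin m → Fin k, Function.Injective r₀ ∧
        r = Fin.castSucc ∘ r₀ := by
    refine ⟨fun l => (r l).castPred (h l), fun x y hxy => hr (Fin.castPred_inj.1 hxy), ?_⟩
    ext l
    simp
  intro m r c hr hc
  by_cases h : ∀ l, r l ≠ Fin.last k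
  · obtain ⟨r₀, hr₀, rfl⟩ := key m r hr h
    have : (Fin.snoc A b : Fin (k + 1) → Fin n → K) ∘ Fin.castSucc ∘ r₀ = A ∘ r₀ := by
      ext i j
      simp
    rw [this]
    exact hA m r₀ c hr₀ hc
  · push Not at h
    obtain ⟨l, hl⟩ := h
    cases m with
    | zero => exact l.elim0
    | succ m =>
      obtain ⟨r', hr'⟩ := exists_swap_eq_snoc r l
      rw [hl] at hr'
      have hi : Function.Injective (Fin.snoc r' (Fin.last k) : Fin (m + 1) → Fin (k + 1)) := by
        rw [← hr']
        exact hr.comp (Equiv.injective _)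
      obtain ⟨hi', hl'⟩ := Fin.snoc_injective_iff.1 hi
      obtain ⟨r₀, hr₀, rfl⟩ := key m r' hi' (by simpa using hl')
      rw [← val_minor_comp_row v _ c (Equiv.swap l (Fin.last m)), Function.comp_assoc, hr',
        ← snoc_comp_castSucc]
      exact hb m r₀ c hr₀ hc

theorem linearIndependent_of_minor_ne_zero {K κ : Type*} [Field K] {m : ℕ} {u : Fin m → κ → K}
    {c : Fin m → κ} (h : minor u c ≠ 0) : LinearIndependent K u := by
  have := Matrix.linearIndependent_rows_of_det_ne_zero h
  exact LinearIndependent.of_comp (LinearMap.funLeft K K c) this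

theorem IsPluckerVector.exists_val_minor_eq {K : Type*} [Field K] (v : AddValuation K (WithTop ℝ))
    {N k : ℕ} {L : Submodule K (Fin N → K)} {p : KSubset N k → K} (h : IsPluckerVector L p)
    {u : Fin k → Fin N → K} (hu : ∀ i, u i ∈ L) (hli : LinearIndependent K u) :
    ∃ t : K, t ≠ 0 ∧ ∀ (c : Fin k → Fin N) (hc : Function.Injective c),
      v (t * minor u c) = v (p ⟨Finset.univ.image c, by
        rw [Finset.card_image_of_injective _ hc, Finset.card_fin]⟩) := by
  obtain ⟨b, e, hb⟩ := h
  obtain ⟨t, ht, hut⟩ := exists_minor_eq_mul b u hu hli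
  refine ⟨e * t⁻¹, mul_ne_zero e.ne_zero (inv_ne_zero ht), fun c hc => ?_⟩
  rw [hut, hb, mul_assoc, inv_mul_cancel_left₀ ht, v.map_mul, v.map_mul]
  congr 1
  refine val_minor_eq_of_image_eq v _ hc (Finset.orderEmbOfFin _ _).injective ?_
  rw [Finset.image_orderEmbOfFin_univ]

/-- The normalization `q ∅ = 1` is forced by the empty minor, and starts the induction on `k`. -/
theorem exists_minorsMatch_of_flag {K : Type*} [Field K] (v : AddValuation K (WithTop ℝ))
    (hres : Infinite (IsLocalRing.ResidueField (valRing v))) {n : ℕ}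
    {q : Finset (Fin n) → K} (hq : ∀ S, q S ≠ 0) (hq1 : q ∅ = 1) (hsub : ValSubmodular v q)
    {L : Fin (n + 1) → Submodule K (Fin n → K)} (hL : Monotone L)
    (hP : ∀ k : Fin (n + 1), IsPluckerVector (k := (k : ℕ)) (L k) fun S => q S.1) (k : ℕ) :
    ∀ hk : k < n + 1, ∃ A : Fin k → Fin n → K, (∀ i, A i ∈ L ⟨k, hk⟩) ∧ MinorsMatch v q A := by
  induction k with
  | zero =>
    refine fun _ => ⟨Fin.elim0, fun i => i.elim0, fun m r c hr hc => ?_⟩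
    obtain rfl : m = 0 := by
      have := Fintype.card_le_of_injective r hr
      simpa using this
    simp [minor, hq1]
  | succ k ih =>
    intro hk
    have hkn : k ≤ n := by omega
    obtain ⟨A, hAL, hA⟩ := ih (by omega)
    have hAL' : ∀ i, A i ∈ L ⟨k + 1, hk⟩ := fun i => hL (Fin.mk_le_mk.2 (Nat.le_succ k)) (hAL i)
    have hdet : minor A (Fin.castLE hkn) ≠ 0 := by
      have := hA k id _ Function.injective_id (Fin.castLE_injective hkn)
      rw [← v.ne_top_iff, ← Function.comp_id A, this, v.ne_top_iff]
      exact hq _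
    have hli := linearIndependent_of_minor_ne_zero hdet
    obtain ⟨a₀, ha₀L, ha₀⟩ : ∃ a ∈ L ⟨k + 1, hk⟩, a ∉ Submodule.span K (Set.range A) := by
      by_contra! h
      obtain ⟨b, -⟩ := hP ⟨k + 1, hk⟩
      have h1 := Submodule.finrank_mono (show L ⟨k + 1, hk⟩ ≤ Submodule.span K (Set.range A) from h)
      rw [Module.finrank_eq_card_basis b, finrank_span_eq_card hli] at h1
      simp at h1
    set P : Matrix (Fin k) (Fin k) K := Matrix.of fun i j => A i (Fin.castLE hkn j) with hPdef
    -- The combination of the rows of `A` that agrees with `a₀` in the first `k` columns; it exists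
    -- because that minor of `A` is nonzero.
    set x : Fin k → K := Matrix.vecMul (a₀ ∘ Fin.castLE hkn) P⁻¹ with hx
    set a₁ := a₀ - ∑ i, x i • A i with ha₁
    have hsum : ∑ i, x i • A i ∈ Submodule.span K (Set.range A) :=
      Submodule.sum_mem _ fun i _ => Submodule.smul_mem _ _ (Submodule.subset_span ⟨i, rfl⟩)
    have ha₁L : a₁ ∈ L ⟨k + 1, hk⟩ :=
      Submodule.sub_mem _ ha₀L (Submodule.sum_mem _ fun i _ => Submodule.smul_mem _ _ (hAL' i))
    have ha₁s : a₁ ∉ Submodule.span K (Set.range A) := fun h => ha₀ <| by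
      have := Submodule.add_mem _ h hsum
      rwa [ha₁, sub_add_cancel] at this
    have hzero : ∀ j : Fin k, a₁ (Fin.castLE hkn j) = 0 := fun j => by
      have h1 : Matrix.vecMul x P = a₀ ∘ Fin.castLE hkn := by
        rw [hx, Matrix.vecMul_vecMul, Matrix.nonsing_inv_mul P (isUnit_iff_ne_zero.2 hdet),
          Matrix.vecMul_one]
      have h2 := congrFun h1 j
      simp only [Matrix.vecMul, dotProduct, hPdef, Matrix.of_apply, Function.comp_apply] at h2
      simp [ha₁, h2]
    have hli' : LinearIndependent K (Fin.snoc A a₁ : Fin (k + 1) → Fin n → K) :=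
      linearIndependent_finSnoc.2 ⟨hli, ha₁s⟩
    obtain ⟨t, ht, htv⟩ := (hP ⟨k + 1, hk⟩).exists_val_minor_eq v
      (u := (Fin.snoc A a₁ : Fin (k + 1) → Fin n → K))
      (fun i => by refine Fin.lastCases ?_ (fun i => ?_) i <;> simp [ha₁L, hAL']) hli'
    have hfull : ∀ c : Fin (k + 1) → Fin n, Function.Injective c →
        v (minor (Fin.snoc A (t • a₁)) c) = v (q (Finset.univ.image c)) := fun c hc => by
      rw [minor_snoc_smul]
      exact htv c hc
    have hle : ∀ (m : ℕ) (r : Fin m → Fin k) (c : Fin (m + 1) → Fin n),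
        Function.Injective r → Function.Injective c →
        v (q (Finset.univ.image c)) ≤ v (minor (Fin.snoc (A ∘ r) (t • a₁)) c) := by
      intro m r c hr hc
      have hm : m ≤ k := by simpa using Fintype.card_le_of_injective r hr
      refine val_le_val_minor_snoc v hkn hq hsub hA (fun j hj => ?_) hfull (k - m) m (by omega)
        r c hr hc
      have := hzero ⟨j, hj⟩
      simp only [Pi.smul_apply, smul_eq_mul]
      rw [show j = Fin.castLE hkn ⟨j, hj⟩ from rfl, this, mul_zero]
    obtain ⟨b, hbL, hb⟩ := exists_val_minor_snoc_eq v hres hq hA hAL'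
      (Submodule.smul_mem _ t ha₁L) hle hfull Finset.univ
    refine ⟨Fin.snoc A b, fun i => ?_, hA.snoc fun m r c hr hc => (hb m r c hr hc).2 ?_⟩
    · refine Fin.lastCases ?_ (fun i => ?_) i <;> simp [hbL, hAL']
    · by_cases h : Function.Surjective r
      · exact Or.inl h
      · simp only [Function.Surjective, not_forall, not_exists] at h
        obtain ⟨s, hs⟩ := h
        exact Or.inr ⟨s, Finset.mem_univ s, hs⟩

/-! ### Minors of `(A | 1)` -/

/-- The matrix `(A | 1)`. -/
def extendOne {K : Type*} [Field K] {n : ℕ} (A : Fin n → Fin n → K) : Fin n → Fin (n + n) → K :=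
  fun i => Fin.append (A i) (Pi.single i 1)

theorem extendOne_castAdd {K : Type*} [Field K] {n : ℕ} (A : Fin n → Fin n → K) (i j : Fin n) :
    extendOne A i (Fin.castAdd n j) = A i j :=
  Fin.append_left _ _ _

theorem extendOne_natAdd {K : Type*} [Field K] {n : ℕ} (A : Fin n → Fin n → K) (i j : Fin n) :
    extendOne A i (Fin.natAdd n j) = if i = j then 1 else 0 := by
  rw [extendOne, Fin.append_right, Pi.single_apply]
  simp [eq_comm]

/-- The set of columns of `(A | 1)` whose minor is, up to sign, the minor of `A` with rows `r` and
columns `c`. -/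
def minorSet {n m : ℕ} (r c : Fin m → Fin n) (hr : Function.Injective r)
    (hc : Function.Injective c) : KSubset (n + n) n :=
  ⟨((Finset.univ.image c).map (Fin.castAddEmb n)).disjUnion
    ((Finset.univ.image r)ᶜ.map (Fin.natAddEmb n)) (by
      rw [Finset.disjoint_left]
      intro x hx hy
      obtain ⟨a, _, rfl⟩ := Finset.mem_map.1 hx
      obtain ⟨b, _, h⟩ := Finset.mem_map.1 hy
      have := congrArg Fin.val h
      simp at this
      omega), by
    have := Fintype.card_le_of_injective r hr
    simp at this
    rw [Finset.card_disjUnion, Finset.card_map, Finset.card_map, Finset.card_compl,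
      Finset.card_image_of_injective _ hc, Finset.card_image_of_injective _ hr]
    simp
    omega⟩

theorem castAdd_mem_minorSet {n m : ℕ} {r c : Fin m → Fin n} (hr : Function.Injective r)
    (hc : Function.Injective c) (i : Fin n) :
    Fin.castAdd n i ∈ (minorSet r c hr hc).1 ↔ i ∈ Finset.univ.image c := by
  simp only [minorSet, Finset.mem_disjUnion, Finset.mem_map]
  constructor
  · rintro (⟨a, ha, h⟩ | ⟨a, _, h⟩)
    · rwa [← Fin.castAdd_injective n n h]
    · have := congrArg Fin.val h
      simp at this
      omega
  · exact fun h => Or.inl ⟨i, h, rfl⟩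

theorem natAdd_mem_minorSet {n m : ℕ} {r c : Fin m → Fin n} (hr : Function.Injective r)
    (hc : Function.Injective c) (i : Fin n) :
    Fin.natAdd n i ∈ (minorSet r c hr hc).1 ↔ i ∉ Finset.univ.image r := by
  simp only [minorSet, Finset.mem_disjUnion, Finset.mem_map]
  constructor
  · rintro (⟨a, ha, h⟩ | ⟨a, ha, h⟩)
    · have := congrArg Fin.val h
      simp at this
      omega
    · rw [← Fin.natAdd_injective n n h]
      exact Finset.mem_compl.1 ha
  · exact fun h => Or.inr ⟨i, Finset.mem_compl.2 h, rfl⟩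

theorem lowerPart_minorSet {n m : ℕ} {r c : Fin m → Fin n} (hr : Function.Injective r)
    (hc : Function.Injective c) : lowerPart (minorSet r c hr hc).1 = Finset.univ.image c := by
  ext i
  rw [lowerPart, Finset.mem_filter, castAdd_mem_minorSet hr hc]
  simp

/-- The rows are those `i` whose unit column is missing from `C`; since `|C| = n`, there are as many
as there are columns of `C` in the first half. -/
theorem exists_eq_minorSet {n : ℕ} (C : KSubset (n + n) n) :
    ∃ (m : ℕ) (r c : Fin m → Fin n) (hr : Function.Injective r) (hc : Function.Injective c),
      C = minorSet r c hr hc := by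
  let R : Finset (Fin n) := Finset.univ.filter fun i => Fin.natAdd n i ∉ C.1
  have hcard : R.card = (lowerPart C.1).card := by
    have h1 : C.1 = (lowerPart C.1).map (Fin.castAddEmb n) ∪ Rᶜ.map (Fin.natAddEmb n) := by
      ext x
      refine Fin.addCases (fun i => ?_) (fun i => ?_) x
      · simp only [Finset.mem_union, Finset.mem_map]
        constructor
        · exact fun h => Or.inl ⟨i, by simpa [lowerPart] using h, rfl⟩
        · rintro (⟨a, ha, h⟩ | ⟨a, _, h⟩)
          · rw [← h]
            simpa [lowerPart] using ha
          · have := congrArg Fin.val h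
            simp at this
            omega
      · simp only [Finset.mem_union, Finset.mem_map]
        constructor
        · exact fun h => Or.inr ⟨i, by simpa [R] using h, rfl⟩
        · rintro (⟨a, _, h⟩ | ⟨a, ha, h⟩)
          · have := congrArg Fin.val h
            simp at this
            omega
          · rw [← h]
            simpa [R] using ha
    have h2 : Disjoint ((lowerPart C.1).map (Fin.castAddEmb n)) (Rᶜ.map (Fin.natAddEmb n)) := by
      rw [Finset.disjoint_left]
      intro x hx hy
      obtain ⟨a, _, rfl⟩ := Finset.mem_map.1 hx
      obtain ⟨b, _, h⟩ := Finset.mem_map.1 hy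
      have := congrArg Fin.val h
      simp at this
      omega
    have h3 := C.2
    rw [h1, Finset.card_union_of_disjoint h2, Finset.card_map, Finset.card_map,
      Finset.card_compl, Fintype.card_fin] at h3
    have := R.card_le_univ
    simp at this
    omega
  refine ⟨_, R.orderEmbOfFin hcard, (lowerPart C.1).orderEmbOfFin rfl,
    (Finset.orderEmbOfFin _ _).injective, (Finset.orderEmbOfFin _ _).injective,
    Subtype.ext (Finset.ext fun x => ?_)⟩
  refine Fin.addCases (fun i => ?_) (fun i => ?_) x
  · rw [castAdd_mem_minorSet, Finset.image_orderEmbOfFin_univ]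
    simp [lowerPart]
  · rw [natAdd_mem_minorSet, Finset.image_orderEmbOfFin_univ]
    simp [R]

/-- List the rows as `r` followed by its complement `t`, and the columns as `c` followed by the unit
columns of `t`. The matrix becomes block lower triangular with an identity block; reordering costs
only signs. -/
theorem val_minor_extendOne {K : Type*} [Field K] (v : AddValuation K (WithTop ℝ)) {n m : ℕ}
    (A : Fin n → Fin n → K) {r c : Fin m → Fin n} (hr : Function.Injective r)
    (hc : Function.Injective c) :
    v (minor (extendOne A) ((minorSet r c hr hc).1.orderEmbOfFin (minorSet r c hr hc).2)) =
      v (minor (A ∘ r) c) := by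
  obtain ⟨l, rfl⟩ : ∃ l, n = m + l := by
    have := Fintype.card_le_of_injective r hr
    simp at this
    exact ⟨n - m, by omega⟩
  have hcard : (Finset.univ.image r)ᶜ.card = l := by
    rw [Finset.card_compl, Finset.card_image_of_injective _ hr]
    simp
  set t := (Finset.univ.image r)ᶜ.orderEmbOfFin hcard with ht
  have htr : ∀ j i, t j ≠ r i := fun j i h => by
    have := Finset.orderEmbOfFin_mem _ hcard j
    rw [← ht, h] at this
    simp at this
  have he : Function.Injective (Fin.append r t) :=
    Fin.append_injective_iff.2 ⟨hr, t.injective, fun i j => (htr j i).symm⟩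
  set d : Fin (m + l) → Fin (m + l + (m + l)) :=
    Fin.append (Fin.castAdd (m + l) ∘ c) (Fin.natAdd (m + l) ∘ t) with hd
  have hdi : Function.Injective d := by
    refine Fin.append_injective_iff.2 ⟨(Fin.castAdd_injective _ _).comp hc,
      (Fin.natAdd_injective _ _).comp t.injective, fun i j h => ?_⟩
    have := congrArg Fin.val h
    simp at this
    omega
  have hdim : Finset.univ.image ((minorSet r c hr hc).1.orderEmbOfFin (minorSet r c hr hc).2) =
      Finset.univ.image d := by
    rw [Finset.image_orderEmbOfFin_univ]
    refine (Finset.eq_of_subset_of_card_le (fun x hx => ?_) ?_).symm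
    · obtain ⟨i, _, rfl⟩ := Finset.mem_image.1 hx
      refine Fin.addCases (fun i => ?_) (fun i => ?_) i
      · rw [hd, Fin.append_left, Function.comp_apply, castAdd_mem_minorSet]
        simp
      · rw [hd, Fin.append_right, Function.comp_apply, natAdd_mem_minorSet]
        simpa using fun x => (htr i x).symm
    · rw [(minorSet r c hr hc).2, Finset.card_image_of_injective _ hdi]
      simp
  rw [val_minor_eq_of_image_eq v _ (Finset.orderEmbOfFin _ _).injective hdi hdim,
    ← val_minor_comp_row v _ d (Equiv.ofBijective _ (Finite.injective_iff_bijective.1 he))]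
  congr 1
  unfold minor
  rw [← Matrix.det_submatrix_equiv_self finSumFinEquiv]
  have : (Matrix.of fun i j => (extendOne A ∘ (Equiv.ofBijective _
      (Finite.injective_iff_bijective.1 he))) i (d j)).submatrix finSumFinEquiv finSumFinEquiv =
      Matrix.fromBlocks (Matrix.of fun i j => (A ∘ r) i (c j)) 0
        (Matrix.of fun i j => A (t i) (c j)) 1 := by
    ext i j
    rcases i with i | i <;> rcases j with j | j <;>
      simp [hd, extendOne_castAdd, extendOne_natAdd, Matrix.one_apply, fun i j => (htr j i).symm,
        -Fin.natAdd_eq_addNat]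
  rw [this, Matrix.det_fromBlocks_zero₁₂, Matrix.det_one, mul_one]

/-! ### The Grassmannian and matrices `(A | 1)` -/

theorem linearIndependent_extendOne {K : Type*} [Field K] {n : ℕ} (A : Fin n → Fin n → K) :
    LinearIndependent K (extendOne A) := by
  refine linearIndependent_of_minor_ne_zero (c := Fin.natAdd n) ?_
  have : (Matrix.of fun i j => extendOne A i (Fin.natAdd n j)) = 1 := by
    ext i j
    rw [Matrix.of_apply, extendOne_natAdd, Matrix.one_apply]
  rw [minor, this, Matrix.det_one]
  exact one_ne_zero

theorem mem_grassmannian_extendOne {K : Type*} [Field K] {n : ℕ} (A : Fin n → Fin n → K) (d : K)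
    (hd : d ≠ 0) : (fun C : KSubset (n + n) n =>
      d * minor (extendOne A) (C.1.orderEmbOfFin C.2)) ∈ grassmannian K n (n + n) := by
  refine ⟨_, Module.Basis.span (linearIndependent_extendOne A), Units.mk0 d hd, fun C => ?_⟩
  simp only [Module.Basis.span_apply, Units.val_mk0]
  rfl

/-- The right half `M₂` of a basis matrix is invertible, its determinant being up to sign and scalar
a coordinate of `x`; multiply by its inverse. -/
theorem exists_eq_mul_minor_extendOne {K : Type*} [Field K] {n : ℕ} {x : KSubset (n + n) n → K}
    (hx : x ∈ grassmannian K n (n + n)) (hx0 : ∀ C, x C ≠ 0) :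
    ∃ (A : Fin n → Fin n → K) (d : K), d ≠ 0 ∧
      ∀ C, x C = d * minor (extendOne A) (C.1.orderEmbOfFin C.2) := by
  obtain ⟨L, b, e, hb⟩ := hx
  set M₁ : Matrix (Fin n) (Fin n) K := Matrix.of fun i j => (b i : _ → K) (Fin.castAdd n j)
  set M₂ : Matrix (Fin n) (Fin n) K := Matrix.of fun i j => (b i : _ → K) (Fin.natAdd n j) with hM₂
  have hdet : M₂.det ≠ 0 := by
    intro h0
    have hi : Function.Injective (Fin.natAdd n : Fin n → Fin (n + n)) := Fin.natAdd_injective _ _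
    have hcard : (Finset.univ.image (Fin.natAdd n : Fin n → Fin (n + n))).card = n := by
      rw [Finset.card_image_of_injective _ hi, Finset.card_fin]
    obtain ⟨σ, hσ⟩ := exists_perm_of_image_eq hi
      (Finset.orderEmbOfFin _ hcard).injective (Finset.image_orderEmbOfFin_univ _ hcard).symm
    apply hx0 ⟨_, hcard⟩
    rw [hb]
    have := Matrix.det_permute' σ M₂
    rw [h0, mul_zero] at this
    have h' : (Matrix.of fun i j : Fin n => (b i : Fin (n + n) → K)
        ((Finset.univ.image (Fin.natAdd n : Fin n → Fin (n + n))).orderEmbOfFin hcard j)) =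
        M₂.submatrix id σ := by
      ext i j
      simp [hσ, hM₂]
    rw [h', this, mul_zero]
  refine ⟨Matrix.of.symm (M₂⁻¹ * M₁), e * M₂.det, mul_ne_zero e.ne_zero hdet, fun C => ?_⟩
  rw [hb, mul_assoc, minor, ← Matrix.det_mul]
  congr 2
  ext i j
  rw [Matrix.mul_apply]
  simp only [Matrix.of_apply]
  refine Fin.addCases (fun l => ?_) (fun l => ?_) (C.1.orderEmbOfFin C.2 j)
  · have : M₁ = M₂ * (M₂⁻¹ * M₁) := by
      rw [Matrix.mul_nonsing_inv_cancel_left _ _ (isUnit_iff_ne_zero.2 hdet)]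
    have := congrFun (congrFun this i) l
    rw [Matrix.mul_apply] at this
    simp only [extendOne_castAdd]
    exact this
  · simp [extendOne_natAdd, hM₂, -Fin.natAdd_eq_addNat]

/-! ### Valuations as real numbers -/

theorem coe_neg_nu {K : Type*} [Field K] (v : AddValuation K (WithTop ℝ)) {a : K} (ha : a ≠ 0) :
    ((-nu v a : ℝ) : WithTop ℝ) = v a := by
  rw [nu, neg_neg]
  exact WithTop.coe_untop₀_of_ne_top (v.ne_top_iff.2 ha)

theorem nu_mul {K : Type*} [Field K] (v : AddValuation K (WithTop ℝ)) {a b : K} (ha : a ≠ 0)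
    (hb : b ≠ 0) : nu v (a * b) = nu v a + nu v b := by
  have h : ((-nu v (a * b) : ℝ) : WithTop ℝ) = ((-nu v a + -nu v b : ℝ) : WithTop ℝ) := by
    rw [WithTop.coe_add, coe_neg_nu v ha, coe_neg_nu v hb, coe_neg_nu v (mul_ne_zero ha hb),
      v.map_mul]
  have := WithTop.coe_injective h
  linarith

theorem nu_sub_le {K : Type*} [Field K] (v : AddValuation K (WithTop ℝ)) {a b c : K} (ha : a ≠ 0)
    (hb : b ≠ 0) (hc : c ≠ 0) (h : c = a - b) : nu v c ≤ max (nu v a) (nu v b) := by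
  have h1 := v.map_sub a b
  rw [← h, ← coe_neg_nu v ha, ← coe_neg_nu v hb, ← coe_neg_nu v hc, ← WithTop.coe_min,
    WithTop.coe_le_coe, min_neg_neg] at h1
  linarith

theorem nu_congr {K : Type*} [Field K] (v : AddValuation K (WithTop ℝ)) {a b : K} (h : v a = v b) :
    nu v a = nu v b := by
  rw [nu, nu, h]

/-! ### From the Grassmannian to flags -/

/-- The columns of `(A | 1)` whose minor is that of the first `|S|` rows of `A` in the columns
`S`. -/
def flagSet {n : ℕ} (S : Finset (Fin n)) : KSubset (n + n) n :=
  minorSet (Fin.castLE (by simpa using S.card_le_univ)) (S.orderEmbOfFin rfl)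
    (Fin.castLE_injective _) (S.orderEmbOfFin rfl).injective

theorem lowerPart_flagSet {n : ℕ} (S : Finset (Fin n)) : lowerPart (flagSet S).1 = S := by
  rw [flagSet, lowerPart_minorSet, Finset.image_orderEmbOfFin_univ]

theorem mem_affineFlagVariety_of_minors {K : Type*} [Field K] {n : ℕ} {A : Fin n → Fin n → K}
    (hA : LinearIndependent K A) {d : K} (hd : d ≠ 0) {q : Finset (Fin n) → K}
    (hq : ∀ (k : ℕ) (hk : k ≤ n) (S : Finset (Fin n)) (hS : S.card = k),
      q S = d * minor (A ∘ Fin.castLE hk) (S.orderEmbOfFin hS)) :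
    q ∈ affineFlagVariety K n := by
  refine ⟨fun k => Submodule.span K (Set.range (A ∘ Fin.castLE (Nat.le_of_lt_succ k.2))),
    fun k l hkl => Submodule.span_mono ?_, fun k => ?_⟩
  · rintro _ ⟨i, rfl⟩
    exact ⟨Fin.castLE hkl i, rfl⟩
  · refine ⟨Module.Basis.span (hA.comp _ (Fin.castLE_injective _)), Units.mk0 d hd, fun S => ?_⟩
    refine (hq k (Nat.le_of_lt_succ k.2) S.1 S.2).trans ?_
    simp only [Module.Basis.span_apply, Units.val_mk0]
    rfl

theorem nu_apply_minorSet {K : Type*} [Field K] (v : AddValuation K (WithTop ℝ)) {n m : ℕ}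
    {x : KSubset (n + n) n → K} {A : Fin n → Fin n → K} {d : K} (hd : d ≠ 0)
    (hx0 : ∀ C, x C ≠ 0) (hx : ∀ C, x C = d * minor (extendOne A) (C.1.orderEmbOfFin C.2))
    {r c : Fin m → Fin n} (hr : Function.Injective r) (hc : Function.Injective c) :
    minor (A ∘ r) c ≠ 0 ∧ nu v (x (minorSet r c hr hc)) = nu v d + nu v (minor (A ∘ r) c) := by
  have h0 := hx0 (minorSet r c hr hc)
  rw [hx] at h0
  have h1 := right_ne_zero_of_mul h0
  refine ⟨?_, ?_⟩
  · rw [← v.ne_top_iff, ← val_minor_extendOne v A hr hc, v.ne_top_iff]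
    exact h1
  · rw [hx, nu_mul v hd h1, nu_congr v (val_minor_extendOne v A hr hc)]

theorem flagSet_mem_nuSet {K : Type*} [Field K] (v : AddValuation K (WithTop ℝ)) {n : ℕ}
    {p : KSubset (n + n) n → ℝ} (hp : p ∈ nuSet v (grassmannian K n (n + n))) :
    (fun S => p (flagSet S)) ∈ nuSet v (affineFlagVariety K n) := by
  obtain ⟨x, ⟨hx, hx0⟩, rfl⟩ := hp
  obtain ⟨A, d, hd, hA⟩ := exists_eq_mul_minor_extendOne hx hx0
  have hle (S : Finset (Fin n)) : S.card ≤ n := by simpa using S.card_le_univ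
  have key (S : Finset (Fin n)) := nu_apply_minorSet v hd hx0 hA
    (Fin.castLE_injective (hle S)) (S.orderEmbOfFin rfl).injective
  -- The determinant of `A` is itself one of the nonzero minors: all rows, all columns.
  have hli : LinearIndependent K A := linearIndependent_of_minor_ne_zero
    (nu_apply_minorSet v hd hx0 hA Function.injective_id Function.injective_id).1
  refine ⟨fun S => d * minor (A ∘ Fin.castLE (hle S)) (S.orderEmbOfFin rfl),
    ⟨mem_affineFlagVariety_of_minors hli hd ?_, fun S => mul_ne_zero hd (key S).1⟩, ?_⟩
  · rintro k hk S rfl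
    rfl
  · ext S
    simp only
    rw [nu_mul v hd (key S).1]
    exact (key S).2.symm

theorem flagSet_mem_tropSet {K : Type*} [Field K] (v : AddValuation K (WithTop ℝ)) {n : ℕ}
    {p : KSubset (n + n) n → ℝ} (hp : p ∈ tropSet v (grassmannian K n (n + n))) :
    (fun S => p (flagSet S)) ∈ tropSet v (affineFlagVariety K n) :=
  map_mem_closure (f := fun p S => p (flagSet S)) (by fun_prop) hp
    fun _ h => flagSet_mem_nuSet v h

/-! ### Submodularity -/

theorem three_term_of_mem_nuSet {K : Type*} [Field K] (v : AddValuation K (WithTop ℝ)) {n m : ℕ}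
    {p : KSubset (n + n) n → ℝ} (hp : p ∈ nuSet v (grassmannian K n (n + n)))
    {U : Fin m → Fin n} {i j : Fin n} (hU : Function.Injective U)
    (hi : Function.Injective (Fin.snoc U i : Fin (m + 1) → Fin n))
    (hj : Function.Injective (Fin.snoc U j : Fin (m + 1) → Fin n))
    (hij : Function.Injective
      (Fin.snoc (Fin.snoc U i : Fin (m + 1) → Fin n) j : Fin (m + 2) → Fin n)) :
    p (minorSet U U hU hU) + p (minorSet _ _ hij hij) ≤
      max (p (minorSet _ _ hi hi) + p (minorSet _ _ hj hj))
        (p (minorSet _ _ hi hj) + p (minorSet _ _ hj hi)) := by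
  obtain ⟨x, ⟨hx, hx0⟩, rfl⟩ := hp
  obtain ⟨A, d, hd, hA⟩ := exists_eq_mul_minor_extendOne hx hx0
  obtain ⟨hUU, hUU'⟩ := nu_apply_minorSet v hd hx0 hA hU hU
  obtain ⟨hb, hb'⟩ := nu_apply_minorSet v hd hx0 hA hij hij
  obtain ⟨hii, hii'⟩ := nu_apply_minorSet v hd hx0 hA hi hi
  obtain ⟨hjj, hjj'⟩ := nu_apply_minorSet v hd hx0 hA hj hj
  obtain ⟨h1, h1'⟩ := nu_apply_minorSet v hd hx0 hA hi hj
  obtain ⟨h2, h2'⟩ := nu_apply_minorSet v hd hx0 hA hj hi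
  have hrel := minor_snoc_snoc (A ∘ U) U (A i) (A j) i j hUU
  simp only [snoc_comp_eq] at hrel
  have := nu_sub_le v (mul_ne_zero hii hjj) (mul_ne_zero h1 h2) (mul_ne_zero hUU hb) hrel
  rw [nu_mul v hUU hb, nu_mul v hii hjj, nu_mul v h1 h2] at this
  simp only
  rw [hUU', hb', hii', hjj', h1', h2']
  rcases le_max_iff.1 this with h | h
  · exact le_max_of_le_left (by linarith)
  · exact le_max_of_le_right (by linarith)

/-- Diminishing returns: enlarging the base set one element at a time (`h1`), then the added set
(`h2`), lowers the marginal gain. Apply this to the base `S ∩ T`, enlarged by `S \ T`, with `T \ S`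
added. -/
theorem mem_submodularCone_of_local {n : ℕ} {F : Finset (Fin n) → ℝ}
    (h : ∀ (U : Finset (Fin n)) (i j : Fin n), i ∉ U → j ∉ U → i ≠ j →
      F U + F (insert j (insert i U)) ≤ F (insert i U) + F (insert j U)) :
    F ∈ submodularCone n := by
  have h1 (U : Finset (Fin n)) (i : Fin n) (D : Finset (Fin n)) (hi : i ∉ U ∪ D) :
      Disjoint D U → F (insert i (U ∪ D)) - F (U ∪ D) ≤ F (insert i U) - F U := by
    induction D using Finset.induction_on with
    | empty => simp
    | insert a D ha ih =>
      intro hd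
      rw [Finset.disjoint_insert_left] at hd
      rw [Finset.union_insert, Finset.mem_insert, not_or] at hi
      have := h (U ∪ D) a i (by simp [hd.1, ha]) hi.2 (Ne.symm hi.1)
      have := ih hi.2 hd.2
      rw [Finset.union_insert]
      linarith
  have h2 (U D E : Finset (Fin n)) (hD : Disjoint D U) :
      Disjoint E (U ∪ D) → F (U ∪ D ∪ E) - F (U ∪ D) ≤ F (U ∪ E) - F U := by
    induction E using Finset.induction_on with
    | empty => simp
    | insert a E ha ih =>
      intro hE
      rw [Finset.disjoint_insert_left, Finset.mem_union, not_or, Finset.disjoint_union_right] at hE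
      have h3 := ih (Finset.disjoint_union_right.2 hE.2)
      have h4 := h1 (U ∪ E) a D (by simp [hE.1.1, hE.1.2, ha])
        (Finset.disjoint_union_right.2 ⟨hD, hE.2.2.symm⟩)
      rw [Finset.union_insert, Finset.union_insert]
      rw [Finset.union_right_comm] at h4
      linarith
  intro S T
  have h3 := h2 (S ∩ T) (S \ T) (T \ S)
    (Finset.disjoint_left.2 fun x hx hx' => by simp at hx hx'; tauto)
    (Finset.disjoint_left.2 fun x hx hx' => by simp at hx hx'; tauto)
  have e1 : S ∩ T ∪ S \ T ∪ T \ S = S ∪ T := by ext; simp; tauto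
  have e2 : S ∩ T ∪ S \ T = S := by ext; simp; tauto
  have e3 : S ∩ T ∪ T \ S = T := by ext; simp; tauto
  rw [e1, e2, e3] at h3
  linarith

theorem local_of_mem_submodularCone {n : ℕ} {F : Finset (Fin n) → ℝ} (hF : F ∈ submodularCone n)
    (U : Finset (Fin n)) {i j : Fin n} (hij : i ≠ j) :
    F U + F (insert j (insert i U)) ≤ F (insert i U) + F (insert j U) := by
  have h := hF (insert i U) (insert j U)
  have e₁ : insert i U ∩ insert j U = U := by
    ext x
    simp only [Finset.mem_inter, Finset.mem_insert]
    constructor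
    · rintro ⟨rfl | h1, rfl | h2⟩
      · exact absurd rfl hij
      all_goals assumption
    · exact fun h => ⟨Or.inr h, Or.inr h⟩
  have e₂ : insert i U ∪ insert j U = insert j (insert i U) := by
    ext x
    simp only [Finset.mem_union, Finset.mem_insert]
    tauto
  rwa [e₁, e₂] at h

theorem flagSet_mem_submodularCone {K : Type*} [Field K] (v : AddValuation K (WithTop ℝ)) {n : ℕ}
    {p : KSubset (n + n) n → ℝ} (hp : p ∈ tropSet v (grassmannian K n (n + n)))
    (hpL : p ∈ Lspace n) : (fun S => p (flagSet S)) ∈ submodularCone n := by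
  refine mem_submodularCone_of_local fun U i j hi hj hij => ?_
  have hU := (U.orderEmbOfFin rfl).injective
  have him := Finset.image_orderEmbOfFin_univ U rfl
  have hmem (l : Fin U.card) : U.orderEmbOfFin rfl l ∈ U := Finset.orderEmbOfFin_mem U rfl l
  generalize (U.orderEmbOfFin rfl : Fin U.card → Fin n) = f at hU him hmem
  have hfi : Function.Injective (Fin.snoc f i : Fin (U.card + 1) → Fin n) :=
    injective_snoc hU fun l h => hi (h ▸ hmem l)
  have hfj : Function.Injective (Fin.snoc f j : Fin (U.card + 1) → Fin n) :=
    injective_snoc hU fun l h => hj (h ▸ hmem l)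
  have hfij : Function.Injective
      (Fin.snoc (Fin.snoc f i : Fin (U.card + 1) → Fin n) j : Fin (U.card + 2) → Fin n) := by
    refine injective_snoc hfi fun l => ?_
    refine Fin.lastCases ?_ (fun l => ?_) l
    · simpa using hij
    · simpa using fun h : f l = j => hj (h ▸ hmem l)
  have hcl : IsClosed {p : KSubset (n + n) n → ℝ |
      p (minorSet f f hU hU) + p (minorSet _ _ hfij hfij) ≤
        max (p (minorSet _ _ hfi hfi) + p (minorSet _ _ hfj hfj))
          (p (minorSet _ _ hfi hfj) + p (minorSet _ _ hfj hfi))} :=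
    isClosed_le (by fun_prop) (by fun_prop)
  have h : p (minorSet f f hU hU) + p (minorSet _ _ hfij hfij) ≤
      max (p (minorSet _ _ hfi hfi) + p (minorSet _ _ hfj hfj))
        (p (minorSet _ _ hfi hfj) + p (minorSet _ _ hfj hfi)) :=
    closure_minimal (fun p hp => three_term_of_mem_nuSet v hp hU hfi hfj hfij) hcl hp
  -- On `Lspace` the rows do not matter, so both arguments of the maximum become the same sum, up to
  -- order.
  have key {m : ℕ} {r c : Fin m → Fin n} (hr : Function.Injective r) (hc : Function.Injective c) :
      p (minorSet r c hr hc) = p (flagSet (Finset.univ.image c)) :=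
    hpL _ _ (by rw [lowerPart_minorSet, lowerPart_flagSet])
  simp only [key, image_snoc, him] at h
  rcases le_max_iff.1 h with h | h
  · exact h
  · linarith

/-! ### From submodular flags to the Grassmannian -/

theorem IsPluckerVector.mul_left {K : Type*} [Field K] {N k : ℕ} {L : Submodule K (Fin N → K)}
    {p : KSubset N k → K} (h : IsPluckerVector L p) {t : K} (ht : t ≠ 0) :
    IsPluckerVector L fun S => t * p S := by
  obtain ⟨b, e, hb⟩ := h
  exact ⟨b, Units.mk0 t ht * e, fun S => by simp only [hb, Units.val_mul, Units.val_mk0, mul_assoc]⟩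

theorem mul_mem_affineFlagVariety {K : Type*} [Field K] {n : ℕ} {q : Finset (Fin n) → K}
    (hq : q ∈ affineFlagVariety K n) {t : ℕ → K} (ht : ∀ k, t k ≠ 0) :
    (fun S => t S.card * q S) ∈ affineFlagVariety K n := by
  obtain ⟨L, hL, hP⟩ := hq
  refine ⟨L, hL, fun k => ?_⟩
  have : (fun S : KSubset n k => t S.1.card * q S.1) = fun S : KSubset n k => t k * q S.1 := by
    ext S
    rw [S.2]
  rw [this]
  exact (hP k).mul_left (ht k)

theorem lowerPart_mem_nuSet {K : Type*} [Field K] (v : AddValuation K (WithTop ℝ))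
    (hres : Infinite (IsLocalRing.ResidueField (valRing v))) {n : ℕ} {F : Finset (Fin n) → ℝ}
    (hF : F ∈ nuSet v (affineFlagVariety K n)) (hsub : F ∈ submodularCone n) :
    (fun C : KSubset (n + n) n => F (lowerPart C.1)) ∈ nuSet v (grassmannian K n (n + n)) := by
  obtain ⟨q, ⟨hq, hq0⟩, rfl⟩ := hF
  -- Divide all of `q` by `q ∅` to normalize; the factor returns as the overall scalar of the
  -- Plücker vector of `(A | 1)`.
  have hinv := inv_ne_zero (hq0 ∅)
  obtain ⟨L, hL, hP⟩ := mul_mem_affineFlagVariety hq (t := fun _ => (q ∅)⁻¹) fun _ => hinv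
  have hs : ValSubmodular v fun S => (q ∅)⁻¹ * q S := by
    intro U i j hi hj hij
    have h := local_of_mem_submodularCone hsub U hij
    have key (S : Finset (Fin n)) := coe_neg_nu v (mul_ne_zero hinv (hq0 S))
    simp only [← key]
    rw [← WithTop.coe_add, ← WithTop.coe_add, WithTop.coe_le_coe]
    simp only [nu_mul v hinv (hq0 _)]
    linarith
  obtain ⟨A, -, hA⟩ := exists_minorsMatch_of_flag v hres (q := fun S => (q ∅)⁻¹ * q S)
    (fun S => mul_ne_zero hinv (hq0 S)) (inv_mul_cancel₀ (hq0 ∅)) hs hL hP n (Nat.lt_succ_self n)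
  have hval (C : KSubset (n + n) n) :
      v (q ∅ * minor (extendOne A) (C.1.orderEmbOfFin C.2)) = v (q (lowerPart C.1)) := by
    obtain ⟨m, r, c, hr, hc, rfl⟩ := exists_eq_minorSet C
    rw [v.map_mul, val_minor_extendOne, hA m r c hr hc, ← v.map_mul, lowerPart_minorSet,
      mul_inv_cancel_left₀ (hq0 ∅)]
  refine ⟨_, ⟨mem_grassmannian_extendOne A (q ∅) (hq0 ∅), fun C => ?_⟩, ?_⟩
  · rw [← v.ne_top_iff, hval, v.ne_top_iff]
    exact hq0 _
  · ext C
    exact nu_congr v (hval C)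

/-! ### Perturbation into the interior of the submodular cone -/

theorem nu_pow {K : Type*} [Field K] (v : AddValuation K (WithTop ℝ)) {a : K} (ha : a ≠ 0)
    (m : ℕ) : nu v (a ^ m) = m * nu v a := by
  induction m with
  | zero => simp [nu]
  | succ m ih =>
    rw [pow_succ, nu_mul v (pow_ne_zero m ha) ha, ih]
    push_cast
    ring

/-- Either `a` or `-a` is a square, and the sign does not change the valuation. Iterating yields
arbitrarily small nonzero values. -/
theorem exists_nu_eq_two_mul {K : Type*} [Field K] (v : AddValuation K (WithTop ℝ))
    (hK : IsAlgClosed K ∨ IsRealClosed K) {a : K} (ha : a ≠ 0) :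
    ∃ b : K, b ≠ 0 ∧ nu v a = 2 * nu v b := by
  have key (b : K) (h : v a = v (b * b)) : b ≠ 0 ∧ nu v a = 2 * nu v b := by
    have hb : b ≠ 0 := by
      rintro rfl
      rw [mul_zero, v.map_zero, v.top_iff] at h
      exact ha h
    exact ⟨hb, by rw [nu_congr v h, nu_mul v hb hb, two_mul]⟩
  rcases hK with h | h
  · obtain ⟨b, hb⟩ := IsAlgClosed.exists_pow_nat_eq a (n := 2) two_pos
    exact ⟨b, key b (by rw [← hb, pow_two])⟩
  · rcases IsRealClosed.isSquare_or_isSquare_neg a with ⟨b, hb⟩ | ⟨b, hb⟩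
    · exact ⟨b, key b (by rw [← hb])⟩
    · exact ⟨b, key b (by rw [← hb, v.map_neg])⟩

theorem exists_nu_neg_gt {K : Type*} [Field K] (v : AddValuation K (WithTop ℝ))
    (hv : valGroup v ≠ ⊥) (hK : IsAlgClosed K ∨ IsRealClosed K) {ε : ℝ} (hε : 0 < ε) :
    ∃ t : K, t ≠ 0 ∧ nu v t < 0 ∧ -ε < nu v t := by
  obtain ⟨a, ha, hna⟩ : ∃ a : K, a ≠ 0 ∧ nu v a < 0 := by
    obtain ⟨⟨γ, a, ha⟩, hγ'⟩ := AddSubgroup.ne_bot_iff_exists_ne_zero.1 hv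
    have hγ : γ ≠ 0 := fun h => hγ' (Subtype.ext h)
    have h1 : nu v (a : K) = -γ := by
      rw [nu, ha]
      rfl
    have h2 : nu v ((a : K)⁻¹) + nu v (a : K) = 0 := by
      rw [← nu_mul v (inv_ne_zero a.ne_zero) a.ne_zero, inv_mul_cancel₀ a.ne_zero]
      simp [nu]
    rcases lt_or_gt_of_ne hγ with h | h
    · exact ⟨_, inv_ne_zero a.ne_zero, by linarith⟩
    · exact ⟨a, a.ne_zero, by linarith⟩
  have hN (N : ℕ) : ∃ b : K, b ≠ 0 ∧ nu v a = 2 ^ N * nu v b := by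
    induction N with
    | zero => exact ⟨a, ha, by simp⟩
    | succ N ih =>
      obtain ⟨b, hb, hab⟩ := ih
      obtain ⟨c, hc, hbc⟩ := exists_nu_eq_two_mul v hK hb
      exact ⟨c, hc, by rw [hab, hbc]; ring⟩
  obtain ⟨N, hN'⟩ := pow_unbounded_of_one_lt (-nu v a / ε) one_lt_two
  obtain ⟨b, hb, hab⟩ := hN N
  have hp : (0 : ℝ) < 2 ^ N := by positivity
  rw [div_lt_iff₀ hε] at hN'
  refine ⟨b, hb, ?_, ?_⟩
  · by_contra! h
    have := mul_nonneg hp.le h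
    linarith
  · by_contra! h
    have := mul_le_mul_of_nonneg_left h hp.le
    linarith

/-- Scaling the Plücker vector of `L k` by `t ^ (k ^ 2)` subtracts `γ * |S| ^ 2`. As `k² + (k + 2)²
- 2(k + 1)² = 2`, each local inequality gains slack `2γ`, which absorbs four approximation errors
below `γ / 2`. -/
theorem mem_closure_inter_submodularCone {K : Type*} [Field K] (v : AddValuation K (WithTop ℝ))
    (hv : valGroup v ≠ ⊥) (hK : IsAlgClosed K ∨ IsRealClosed K) {n : ℕ}
    {F : Finset (Fin n) → ℝ} (hF : F ∈ tropSet v (affineFlagVariety K n))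
    (hsub : F ∈ submodularCone n) :
    F ∈ closure (nuSet v (affineFlagVariety K n) ∩ submodularCone n) := by
  rw [Metric.mem_closure_iff]
  intro η hη
  have hn : (0 : ℝ) < (n : ℝ) ^ 2 + 1 := by positivity
  -- Half of `η` is for the correction, at most `γ * n ^ 2`, and half for the approximation; the `+
  -- 1` avoids division by zero at `n = 0`.
  obtain ⟨t, ht, ht0, htη⟩ := exists_nu_neg_gt v hv hK (ε := η / 2 / ((n : ℝ) ^ 2 + 1))
    (by positivity)
  set γ := -nu v t with hγ
  have hγ0 : 0 < γ := by linarith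
  have hγη : γ * ((n : ℝ) ^ 2 + 1) < η / 2 := by
    rw [← lt_div_iff₀ hn]
    linarith
  obtain ⟨F', hF', hFF'⟩ := Metric.mem_closure_iff.1 hF (min (γ / 2) (η / 2))
    (lt_min (by linarith) (by linarith))
  have hd (S : Finset (Fin n)) : |F S - F' S| < min (γ / 2) (η / 2) :=
    (dist_le_pi_dist F F' S).trans_lt hFF'
  have hdγ (S : Finset (Fin n)) := abs_lt.1 ((hd S).trans_le (min_le_left _ _))
  have hdη (S : Finset (Fin n)) := abs_lt.1 ((hd S).trans_le (min_le_right _ _))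
  refine ⟨fun S => F' S - γ * (S.card : ℝ) ^ 2, ⟨?_, ?_⟩, ?_⟩
  · obtain ⟨x, ⟨hx, hx0⟩, rfl⟩ := hF'
    refine ⟨_, ⟨mul_mem_affineFlagVariety hx (t := fun k => t ^ (k ^ 2)) fun k => pow_ne_zero _ ht,
      fun S => mul_ne_zero (pow_ne_zero _ ht) (hx0 S)⟩, ?_⟩
    ext S
    simp only
    rw [nu_mul v (pow_ne_zero _ ht) (hx0 S), nu_pow v ht, hγ]
    push_cast
    ring
  · refine mem_submodularCone_of_local fun U i j hi hj hij => ?_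
    have h := local_of_mem_submodularCone hsub U hij
    have hj' : j ∉ insert i U := by simp [hj, hij.symm]
    simp only [Finset.card_insert_of_notMem hi, Finset.card_insert_of_notMem hj,
      Finset.card_insert_of_notMem hj']
    push_cast
    have := hdγ U
    have := hdγ (insert i U)
    have := hdγ (insert j U)
    have := hdγ (insert j (insert i U))
    nlinarith
  · refine (dist_pi_lt_iff hη).2 fun S => ?_
    have hS : ((S.card : ℝ)) ^ 2 ≤ (n : ℝ) ^ 2 := by
      have : S.card ≤ n := by simpa using S.card_le_univ
      gcongr
    have h1 : γ * (S.card : ℝ) ^ 2 ≤ γ * (n : ℝ) ^ 2 := by gcongr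
    have h2 : 0 ≤ γ * (S.card : ℝ) ^ 2 := by positivity
    have := hdη S
    rw [Real.dist_eq, abs_lt]
    constructor <;> nlinarith

theorem lowerPart_mem_tropSet {K : Type*} [Field K] (v : AddValuation K (WithTop ℝ))
    (hres : Infinite (IsLocalRing.ResidueField (valRing v)))
    (hv : valGroup v ≠ ⊥) (hK : IsAlgClosed K ∨ IsRealClosed K) {n : ℕ}
    {F : Finset (Fin n) → ℝ} (hF : F ∈ tropSet v (affineFlagVariety K n))
    (hsub : F ∈ submodularCone n) :
    (fun C : KSubset (n + n) n => F (lowerPart C.1)) ∈ tropSet v (grassmannian K n (n + n)) :=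
  map_mem_closure (f := fun (F : Finset (Fin n) → ℝ) (C : KSubset (n + n) n) => F (lowerPart C.1))
    (by fun_prop) (mem_closure_inter_submodularCone v hv hK hF hsub)
    fun _ h => lowerPart_mem_nuSet v hres h.1 h.2

/-! ### The theorem -/

/-- On `Lspace`, `flagSet S` and `extendSet S` give the same value, having the same lower part.
Hence the coordinates that form a flag may be used to read off `F`. -/
theorem inter_Lspace_eq_inLspace {n : ℕ} {G : Set (KSubset (n + n) n → ℝ)}
    {B : Set (Finset (Fin n) → ℝ)}
    (h₁ : ∀ p ∈ G, p ∈ Lspace n → (fun S => p (flagSet S)) ∈ B)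
    (h₂ : ∀ F ∈ B, (fun C : KSubset (n + n) n => F (lowerPart C.1)) ∈ G) :
    G ∩ (Lspace n : Set (KSubset (n + n) n → ℝ)) = inLspace B := by
  ext p
  constructor
  · rintro ⟨hp, hpL⟩
    refine ⟨_, h₁ p hp hpL, ?_⟩
    ext C
    exact hpL _ _ (lowerPart_flagSet _)
  · rintro ⟨F, hF, rfl⟩
    exact ⟨h₂ F hF, ((LspaceEquiv n).symm F).2⟩

theorem mainTheorem2 {K : Type*} [Field K] (v : AddValuation K (WithTop ℝ))
    (hsplit : HasSplitting v)
    (hres : Infinite (IsLocalRing.ResidueField (valRing v)))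
    (n : ℕ) (hn : 0 < n) :
    nuSet v (grassmannian K n (n + n)) ∩ (Lspace n : Set (KSubset (n + n) n → ℝ)) =
        inLspace (nuSet v (affineFlagVariety K n) ∩ submodularCone n) ∧
      (valGroup v ≠ ⊥ → (IsAlgClosed K ∨ IsRealClosed K) →
        tropSet v (grassmannian K n (n + n)) ∩ (Lspace n : Set (KSubset (n + n) n → ℝ)) =
          inLspace (tropSet v (affineFlagVariety K n) ∩ submodularCone n)) := by
  refine ⟨inter_Lspace_eq_inLspace (fun p hp hpL => ⟨flagSet_mem_nuSet v hp,
      flagSet_mem_submodularCone v (subset_closure hp) hpL⟩) fun F hF =>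
      lowerPart_mem_nuSet v hres hF.1 hF.2, fun hv hK => ?_⟩
  exact inter_Lspace_eq_inLspace (fun p hp hpL => ⟨flagSet_mem_tropSet v hp,
    flagSet_mem_submodularCone v hp hpL⟩) fun F hF =>
    lowerPart_mem_tropSet v hres hv hK hF.1 hF.2
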